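/- Let $\mathbb{T}=\mathbb{R}/2\pi\mathbb{Z}$, and for $1<p<\infty$ let $L^p(\mathbb{T})$ be the space of complex-valued measurable functions $f$ on $\mathbb{T}$ with $$\|f\|_{L^p(\mathbb{T})}=\Big(\frac1{2\pi}\int_{\mathbb{T}}|f(t)|^p\,dt\Big)^{1/p}<\infty .$$ For $f\in L^p(\mathbb{T})$ and $n\ge 0$ let $$S_n(f)(t)=\sum_{j=-n}^{n}\widehat f(j)\,e^{ijt},\qquad \widehat f(j)=\frac1{2\pi}\int_{\mathbb{T}}f(t)e^{-ijt}\,dt .$$ **Theorem 9.5 (Fourier series converge in $L^p(\mathbb{T})$).** Let $1<p<\infty$. Then for each $f\in L^p(\mathbb{T})$, every $S_n(f)$ belongs to $L^p(\mathbb{T})$ and $$\lim_{n\to\infty}\|S_n(f)-f\|_{L^p(\mathbb{T})}=0 .$$ -/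

import Mathlib

open MeasureTheory Filter Topology
open scoped ENNReal

/-- The period `2π` is positive; this provides Mathlib's normalised measure and Fourier
coefficients on `ℝ / 2πℤ`. -/
instance factTwoPiPos : Fact (0 < 2 * Real.pi) := ⟨Real.two_pi_pos⟩

/-- The one-dimensional torus `ℝ / 2πℤ`. -/
abbrev Torus : Type := AddCircle (2 * Real.pi)

/-- The measure `(1 / 2π) dt` on the torus (total mass one). -/
noncomputable abbrev torusMeasure : Measure Torus := AddCircle.haarAddCircle

/-- The `n`-th symmetric partial sum `∑_{|j| ≤ n} f̂(j) e^{ijt}` of the Fourier series of `f`.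
Here `fourierCoeff f j = (1 / 2π) ∫ f(t) e^{-ijt} dt` and `fourier j t = e^{ijt}`. -/
noncomputable def fourierPartialSum (n : ℕ) (f : Torus → ℂ) (t : Torus) : ℂ :=
  ∑ j ∈ Finset.Icc (-(n : ℤ)) (n : ℤ), fourierCoeff f j * fourier j t

/-! Trigonometric polynomials are dense in `L^p`, and `S_n` fixes each of them for large `n`; so
convergence follows once the operators `S_n` are bounded on `L^p` uniformly in `n`
(`exists_eLpNorm_fourierPartialSum_le`).

Since `S_n` is a difference of two frequency-shifted copies of the projection `P` to nonnegative
frequencies, and shifts are isometric, it is enough to bound `P`. For `1 < p ≤ 2` this is M. Riesz's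
complex-variable argument. If `f` is a positive trigonometric polynomial, `F = 2 P f - f̂(0)`
extends to an entire function with real part `f` on the circle. Then `F ^ p` is holomorphic on the
closed disc, and its mean is `F(0) ^ p ≥ 0`. Integrating the pointwise bound `‖w‖ ^ p ≤ A (re w) ^ p
- B re (w ^ p)` therefore gives `‖F‖_p ≤ A^{1/p} ‖f‖_p` (`integral_norm_rpow_le_of_re_pos`).

A general polynomial is split into four nonnegative parts, each approximated uniformly by positive
polynomials; the uniform error is harmless because `P` contracts `L²` and `p ≤ 2`
(`exists_eLpNorm_filter_nonneg_le`). Exponents `p ≥ 2` follow by duality, `S_n` being symmetric. -/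

open scoped ComplexConjugate

/-! ### M. Riesz's inequality for holomorphic functions -/

/-- In the right half plane, `‖w‖ ^ p` is controlled by `(re w) ^ p` up to a multiple of the
harmonic function `re (w ^ p)`. -/
theorem exists_norm_rpow_le_of_re_pos {p : ℝ} (hp : 1 < p) (hp2 : p ≤ 2) :
    ∃ A B : ℝ, 0 ≤ A ∧ 0 ≤ B ∧ ∀ w : ℂ, 0 < w.re →
      ‖w‖ ^ p ≤ A * w.re ^ p - B * (w ^ (p : ℂ)).re := by
  have hπ := Real.pi_pos
  -- Any angle strictly between `π / (2p)` and `π / 2` serves: `cos θ > 0` while `cos (p θ) < 0`.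
  set θ : ℝ := (Real.pi / (2 * p) + Real.pi / 2) / 2 with hθ
  have hpi : Real.pi / (2 * p) < Real.pi / 2 := by
    apply div_lt_div_of_pos_left hπ <;> linarith
  have hpi0 : 0 < Real.pi / (2 * p) := by positivity
  have hθ2 : θ < Real.pi / 2 := by linarith
  have hθ0 : 0 < θ := by linarith
  have hpθ : Real.pi / 2 < p * θ := by
    have h1 : Real.pi / (2 * p) < θ := by linarith
    calc Real.pi / 2 = p * (Real.pi / (2 * p)) := by field_simp
      _ < p * θ := by gcongr
  have hpθ' : p * θ < Real.pi := by nlinarith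
  have hκ : Real.cos (p * θ) < 0 :=
    Real.cos_neg_of_pi_div_two_lt_of_lt hpθ (by linarith)
  have hc : 0 < Real.cos θ := Real.cos_pos_of_mem_Ioo ⟨by linarith, hθ2⟩
  set B : ℝ := (-Real.cos (p * θ))⁻¹ with hB
  have hB0 : 0 < B := by rw [hB]; exact inv_pos.2 (by linarith)
  have hBκ : B * Real.cos (p * θ) = -1 := by
    rw [hB, inv_neg, neg_mul, inv_mul_cancel₀ hκ.ne]
  set A : ℝ := (1 + B) / Real.cos θ ^ p with hA
  have hcp : 0 < Real.cos θ ^ p := Real.rpow_pos_of_pos hc p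
  have hA0 : 0 < A := by positivity
  refine ⟨A, B, hA0.le, hB0.le, fun w hw => ?_⟩
  have hw0 : w ≠ 0 := by rintro rfl; simp at hw
  have harg : |w.arg| < Real.pi / 2 := Complex.abs_arg_lt_pi_div_two_iff.2 (Or.inl hw)
  have hre : w.re = ‖w‖ * Real.cos |w.arg| := by
    rw [Real.cos_abs, Complex.norm_mul_cos_arg]
  have hcos0 : 0 < Real.cos |w.arg| :=
    Real.cos_pos_of_mem_Ioo ⟨by linarith [abs_nonneg w.arg], harg⟩
  have hmul : Real.cos (w.arg * p) = Real.cos (p * |w.arg|) := by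
    rw [← Real.cos_abs, abs_mul, abs_of_pos (by linarith : 0 < p), mul_comm]
  -- The inequality divided by `‖w‖ ^ p`. For arguments up to `θ`, `A` absorbs both 1 and the `B`
  -- term; beyond `θ`, the choice `B cos (p θ) = -1` suffices, since `p |arg w| ≤ π` by `p ≤ 2` and
  -- cosine decreases there.
  have key : 1 ≤ A * Real.cos |w.arg| ^ p - B * Real.cos (p * |w.arg|) := by
    rcases le_total |w.arg| θ with h | h
    · have h1 : Real.cos θ ≤ Real.cos |w.arg| :=
        Real.cos_le_cos_of_nonneg_of_le_pi (abs_nonneg _) (by linarith) h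
      have h2 : Real.cos θ ^ p ≤ Real.cos |w.arg| ^ p :=
        Real.rpow_le_rpow hc.le h1 (by linarith)
      have h3 : 1 + B = A * Real.cos θ ^ p := by rw [hA]; field_simp
      have h4 := mul_le_mul_of_nonneg_left h2 hA0.le
      have h5 := mul_le_mul_of_nonneg_left (Real.cos_le_one (p * |w.arg|)) hB0.le
      linarith
    · have h1 : Real.cos (p * |w.arg|) ≤ Real.cos (p * θ) := by
        apply Real.cos_le_cos_of_nonneg_of_le_pi (by linarith)
        · nlinarith [abs_nonneg w.arg]
        · gcongr
      have h2 := mul_le_mul_of_nonneg_left h1 hB0.le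
      have h3 : 0 ≤ A * Real.cos |w.arg| ^ p := by positivity
      linarith
  rw [Complex.cpow_ofReal_re, hmul, hre, Real.mul_rpow (norm_nonneg _) hcos0.le]
  have := mul_le_mul_of_nonneg_left key (Real.rpow_nonneg (norm_nonneg w) p)
  linarith

theorem circleAverage_eq_integral_torus {E : Type*} [NormedAddCommGroup E] [NormedSpace ℝ E]
    (h : ℂ → E) :
    Real.circleAverage h 0 1 = ∫ t : Torus, h (fourier 1 t) ∂torusMeasure := by
  rw [AddCircle.integral_haarAddCircle, ← AddCircle.intervalIntegral_preimage (2 * Real.pi) 0,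
    Real.circleAverage_def, zero_add]
  congr 1
  refine intervalIntegral.integral_congr fun x _ => ?_
  simp only [fourier_coe_apply, circleMap]
  congr 1
  have : (Real.pi : ℂ) ≠ 0 := by exact_mod_cast Real.pi_ne_zero
  simp only [Complex.ofReal_one, one_mul, zero_add, Int.cast_one, mul_one, Complex.ofReal_mul,
    Complex.ofReal_ofNat]
  congr 1
  field_simp

/-- An entire function with positive real part on the unit circle has positive real part on the
closed unit disc. -/
theorem re_pos_of_re_pos_on_sphere {F : ℂ → ℂ} (hF : Differentiable ℂ F)
    (hpos : ∀ z ∈ Metric.sphere (0 : ℂ) 1, 0 < (F z).re) {z : ℂ}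
    (hz : z ∈ Metric.closedBall (0 : ℂ) 1) : 0 < (F z).re := by
  obtain ⟨z₀, hz₀, hmin⟩ := (isCompact_sphere (0 : ℂ) 1).exists_isMinOn
    ⟨1, by simp⟩ (Complex.continuous_re.comp hF.continuous).continuousOn
  -- The modulus of `exp (-F)` is `exp (-re F)`, so the maximum principle for it is a minimum
  -- principle for `re F`.
  have hG : Differentiable ℂ fun z => Complex.exp (-F z) := hF.neg.cexp
  have := Complex.norm_le_of_forall_mem_frontier_norm_le (Metric.isBounded_ball (x := (0 : ℂ))
    (r := 1)) hG.diffContOnCl (C := Real.exp (-(F z₀).re)) (fun w hw => ?_)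
    (z := z) (by rwa [closure_ball _ one_ne_zero])
  · rw [Complex.norm_exp, Real.exp_le_exp] at this
    have h0 := hpos z₀ hz₀
    simp at this
    linarith
  · rw [frontier_ball _ one_ne_zero] at hw
    rw [Complex.norm_exp, Real.exp_le_exp]
    simpa using hmin hw

/-- The mean value property for `F ^ p`. -/
theorem integral_cpow_eq_of_re_pos {F : ℂ → ℂ} (hF : Differentiable ℂ F)
    (hpos : ∀ z ∈ Metric.sphere (0 : ℂ) 1, 0 < (F z).re) (p : ℝ) :
    ∫ t : Torus, F (fourier 1 t) ^ (p : ℂ) ∂torusMeasure = F 0 ^ (p : ℂ) := by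
  rw [← circleAverage_eq_integral_torus (fun z => F z ^ (p : ℂ))]
  have hd : DiffContOnCl ℂ (fun z => F z ^ (p : ℂ)) (Metric.ball 0 |1|) := by
    apply DifferentiableOn.diffContOnCl
    rw [abs_one, closure_ball _ one_ne_zero]
    intro z hz
    exact ((hF z).cpow (differentiableAt_const _)
      (Or.inl (re_pos_of_re_pos_on_sphere hF hpos hz))).differentiableWithinAt
  exact hd.circleAverage

/-- M. Riesz's inequality: for an entire function with positive real part on the unit circle,
which is real at the origin, the `L ^ p` mean on the circle is controlled by that of its real
part. -/
theorem integral_norm_rpow_le_of_re_pos {p A B : ℝ} (hp : 1 < p) (hB : 0 ≤ B)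
    (hAB : ∀ w : ℂ, 0 < w.re → ‖w‖ ^ p ≤ A * w.re ^ p - B * (w ^ (p : ℂ)).re)
    {F : ℂ → ℂ} (hF : Differentiable ℂ F)
    (hpos : ∀ z ∈ Metric.sphere (0 : ℂ) 1, 0 < (F z).re) (h0 : (F 0).im = 0) :
    ∫ t : Torus, ‖F (fourier 1 t)‖ ^ p ∂torusMeasure ≤
      A * ∫ t : Torus, (F (fourier 1 t)).re ^ p ∂torusMeasure := by
  have hp0 : 0 < p := by linarith
  have hs : ∀ t : Torus, fourier 1 t ∈ Metric.sphere (0 : ℂ) 1 := fun t => by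
    rw [fourier_apply, mem_sphere_zero_iff_norm]; exact Circle.norm_coe _
  have hcF : Continuous fun t : Torus => F (fourier 1 t) :=
    hF.continuous.comp (map_continuous _)
  have int {E : Type} [NormedAddCommGroup E] {g : Torus → E} (hg : Continuous g) :
      Integrable g torusMeasure := by
    exact hg.integrable_of_hasCompactSupport (HasCompactSupport.of_compactSpace g)
  have i1 : Integrable (fun t : Torus => ‖F (fourier 1 t)‖ ^ p) torusMeasure :=
    int (hcF.norm.rpow_const fun _ => Or.inr hp0.le)
  have i2 : Integrable (fun t : Torus => (F (fourier 1 t)).re ^ p) torusMeasure :=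
    int ((Complex.continuous_re.comp hcF).rpow_const fun _ => Or.inr hp0.le)
  have i3 : Integrable (fun t : Torus => F (fourier 1 t) ^ (p : ℂ)) torusMeasure :=
    int (hcF.cpow continuous_const fun t => Or.inl (hpos _ (hs t)))
  have hmean : ∫ t : Torus, (F (fourier 1 t) ^ (p : ℂ)).re ∂torusMeasure
      = (F 0 ^ (p : ℂ)).re := by
    rw [← integral_cpow_eq_of_re_pos hF hpos p]
    exact integral_re i3
  have hre0 : 0 < (F 0).re := re_pos_of_re_pos_on_sphere hF hpos (by simp)
  -- `F 0` is a positive real, hence so is its power; the `B` term can then be dropped.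
  have h00 : 0 ≤ (F 0 ^ (p : ℂ)).re := by
    have : F 0 = ((F 0).re : ℂ) := by apply Complex.ext <;> simp [h0]
    rw [this, ← Complex.ofReal_cpow hre0.le, Complex.ofReal_re]
    positivity
  calc _ ≤ ∫ t : Torus, (A * (F (fourier 1 t)).re ^ p
          - B * (F (fourier 1 t) ^ (p : ℂ)).re) ∂torusMeasure :=
        integral_mono i1 ((i2.const_mul A).sub (i3.re.const_mul B))
          fun t => hAB _ (hpos _ (hs t))
    _ = A * (∫ t : Torus, (F (fourier 1 t)).re ^ p ∂torusMeasure)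
          - B * (F 0 ^ (p : ℂ)).re := by
        rw [← hmean, ← integral_const_mul, ← integral_const_mul]
        exact integral_sub (i2.const_mul A) (i3.re.const_mul B)
    _ ≤ _ := by nlinarith

/-! ### Trigonometric polynomials and their coefficients -/

/-- The trigonometric polynomial `∑ a_j e^{ijt}` with finitely supported coefficients. -/
noncomputable def trigPoly : (ℤ →₀ ℂ) →ₗ[ℂ] C(Torus, ℂ) :=
  Finsupp.linearCombination ℂ (fun j => fourier j)

theorem trigPoly_apply (a : ℤ →₀ ℂ) (t : Torus) :
    trigPoly a t = a.sum fun j c => c * fourier j t := by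
  simp [trigPoly, Finsupp.linearCombination_apply, Finsupp.sum]

theorem trigPoly_single (j : ℤ) (c : ℂ) : trigPoly (Finsupp.single j c) = c • fourier j := by
  simp [trigPoly]

theorem norm_fourier_apply (n : ℤ) (t : Torus) : ‖fourier n t‖ = 1 := by
  rw [fourier_apply]; exact Circle.norm_coe _

theorem ContinuousMap.memLp_torus (f : C(Torus, ℂ)) (p : ℝ≥0∞) : MemLp f p torusMeasure :=
  f.continuous.memLp_of_hasCompactSupport (HasCompactSupport.of_compactSpace f)

theorem toLp_trigPoly (a : ℤ →₀ ℂ) :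
    ContinuousMap.toLp (E := ℂ) 2 torusMeasure ℂ (trigPoly a) =
      Finsupp.linearCombination ℂ (fourierLp 2) a := by
  simp [trigPoly, Finsupp.linearCombination_apply, Finsupp.sum, map_sum]

theorem fourierCoeff_trigPoly (a : ℤ →₀ ℂ) (j : ℤ) : fourierCoeff (trigPoly a) j = a j := by
  rw [← (orthonormal_fourier (T := 2 * Real.pi)).inner_right_finsupp a j, ← toLp_trigPoly,
    ← coe_fourierBasis, ← fourierBasis.repr_apply_apply, fourierBasis_repr]
  exact (congrFun (fourierCoeff_congr_ae (ContinuousMap.coeFn_toLp _ _)) j).symm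

theorem enorm_fourierCoeff_le {f : Torus → ℂ} {p : ℝ≥0∞} (hp : 1 ≤ p)
    (hf : AEStronglyMeasurable f torusMeasure) (j : ℤ) :
    ‖fourierCoeff f j‖ₑ ≤ eLpNorm f p torusMeasure := by
  refine le_trans ?_ (eLpNorm_le_eLpNorm_of_exponent_le hp hf)
  rw [eLpNorm_one_eq_lintegral_enorm]
  refine (enorm_integral_le_lintegral_enorm _).trans (le_of_eq ?_)
  congr 1; ext t
  rw [smul_eq_mul, enorm_mul, ← ofReal_norm, norm_fourier_apply]
  simp

/-- Coefficient projections do not increase the `L²` norm of trigonometric polynomials. -/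
theorem eLpNorm_two_trigPoly_filter_le (a : ℤ →₀ ℂ) (q : ℤ → Prop) [DecidablePred q] :
    eLpNorm (trigPoly (a.filter q)) 2 torusMeasure ≤ eLpNorm (trigPoly a) 2 torusMeasure := by
  have h (b : ℤ →₀ ℂ) : eLpNorm (trigPoly b) 2 torusMeasure =
      ‖Finsupp.linearCombination ℂ (fourierLp (T := 2 * Real.pi) 2) b‖ₑ := by
    rw [← toLp_trigPoly, Lp.enorm_def]
    exact (eLpNorm_congr_ae (ContinuousMap.coeFn_toLp _ _)).symm
  rw [h, h, ← ofReal_norm, ← ofReal_norm]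
  apply ENNReal.ofReal_le_ofReal
  conv_rhs => rw [← Finsupp.filter_add_filter_not a q, map_add]
  have horth : inner ℂ (Finsupp.linearCombination ℂ (fourierLp (T := 2 * Real.pi) 2) (a.filter q))
      (Finsupp.linearCombination ℂ (fourierLp 2) (a.filter fun j => ¬ q j)) = 0 := by
    rw [orthonormal_fourier.inner_finsupp_eq_sum_left]
    refine Finset.sum_eq_zero fun j _ => ?_
    by_cases hj : q j <;> simp [hj]
  have := norm_add_sq_eq_norm_sq_add_norm_sq_of_inner_eq_zero _ _ horth
  nlinarith [norm_nonneg (Finsupp.linearCombination ℂ (fourierLp (T := 2 * Real.pi) 2)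
    (a.filter q) + Finsupp.linearCombination ℂ (fourierLp 2) (a.filter fun j => ¬ q j)),
    norm_nonneg (Finsupp.linearCombination ℂ (fourierLp (T := 2 * Real.pi) 2) (a.filter q)),
    mul_self_nonneg ‖(Finsupp.linearCombination ℂ (fourierLp (T := 2 * Real.pi) 2)
      (a.filter fun j => ¬ q j))‖]

/-! ### The projection to nonnegative frequencies -/

/-- The analytic extension to the plane of the nonnegative frequency part of a trigonometric
polynomial. -/
noncomputable def analyticPart (a : ℤ →₀ ℂ) (z : ℂ) : ℂ :=
  (a.filter (0 ≤ ·)).sum fun j c => c * z ^ j.toNat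

theorem differentiable_analyticPart (a : ℤ →₀ ℂ) : Differentiable ℂ (analyticPart a) := by
  unfold analyticPart Finsupp.sum
  fun_prop

theorem fourier_natCast_eq_pow (n : ℕ) (t : Torus) :
    fourier (n : ℤ) t = fourier 1 t ^ n := by
  induction n with
  | zero => simp
  | succ n ih => rw [Nat.cast_succ, fourier_add, ih, pow_succ]

theorem analyticPart_fourier (a : ℤ →₀ ℂ) (t : Torus) :
    analyticPart a (fourier 1 t) = trigPoly (a.filter (0 ≤ ·)) t := by
  rw [trigPoly_apply, analyticPart]
  refine Finset.sum_congr rfl fun j hj => ?_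
  have h0 : 0 ≤ j := by simp [Finsupp.support_filter] at hj; exact hj.2
  dsimp only
  conv_rhs => rw [← Int.toNat_of_nonneg h0, fourier_natCast_eq_pow]
  rw [← Int.toNat_of_nonneg h0]
  simp

theorem analyticPart_zero (a : ℤ →₀ ℂ) : analyticPart a 0 = a 0 := by
  rw [analyticPart, Finsupp.sum, Finset.sum_eq_single 0]
  · simp
  · intro j hj hj0
    have h0 : 0 ≤ j := by simp [Finsupp.support_filter] at hj; exact hj.2
    have : j.toNat ≠ 0 := by omega
    simp [this]
  · intro h
    have : (a.filter (0 ≤ ·)) 0 = 0 := by simpa using h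
    simp [this]

/-- The coefficients of the complex conjugate of a trigonometric polynomial. -/
theorem conj_trigPoly (a : ℤ →₀ ℂ) (t : Torus) :
    conj (trigPoly a t) =
      trigPoly ((a.mapRange (starRingEnd ℂ) (map_zero _)).equivMapDomain (Equiv.neg ℤ)) t := by
  rw [trigPoly_apply, trigPoly_apply, Finsupp.sum_equivMapDomain,
    Finsupp.sum_mapRange_index (by simp), Finsupp.sum, map_sum]
  refine Finset.sum_congr rfl fun j _ => ?_
  simp only [map_mul, Equiv.neg_apply, fourier_neg]

theorem coeff_neg_of_im_eq_zero {a : ℤ →₀ ℂ} (ha : ∀ t, (trigPoly a t).im = 0) (j : ℤ) :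
    a (-j) = conj (a j) := by
  rw [← fourierCoeff_trigPoly a, ← fourierCoeff_trigPoly a, fourierCoeff, fourierCoeff,
    ← integral_conj]
  congr 1; ext t
  rw [smul_eq_mul, smul_eq_mul, map_mul, ← fourier_neg, Complex.conj_eq_iff_im.2 (ha t)]

/-- For a real polynomial, conjugation reflects the nonnegative frequencies onto the nonpositive
ones, so the sum with the conjugate counts frequency zero twice. -/
theorem two_mul_re_trigPoly_filter {a : ℤ →₀ ℂ} (ha : ∀ t, (trigPoly a t).im = 0) (t : Torus) :
    2 * (trigPoly (a.filter (0 ≤ ·)) t).re = (trigPoly a t).re + (a 0).re := by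
  have h1 : trigPoly (a.filter (0 ≤ ·)) t + conj (trigPoly (a.filter (0 ≤ ·)) t)
      = trigPoly a t + a 0 := by
    rw [conj_trigPoly, ← ContinuousMap.add_apply, ← map_add]
    have : a 0 = trigPoly (Finsupp.single 0 (a 0)) t := by
      rw [trigPoly_single, ContinuousMap.smul_apply, fourier_zero, smul_eq_mul, mul_one]
    conv_rhs => rw [this, ← ContinuousMap.add_apply, ← map_add]
    congr 2
    ext j
    have hj := coeff_neg_of_im_eq_zero ha (-j)
    rw [neg_neg] at hj
    simp only [Finsupp.add_apply, Finsupp.filter_apply, Finsupp.equivMapDomain_apply,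
      Finsupp.mapRange_apply, Finsupp.single_apply, Equiv.neg_symm, Equiv.neg_apply]
    rcases lt_trichotomy j 0 with h | h | h
    · rw [if_neg (by omega), if_pos (by omega), if_neg (by omega), hj]; simp
    · subst h
      simp at hj
      simp [← hj]
    · rw [if_pos (by omega), if_neg (by omega), if_neg (by omega)]; simp
  have h2 := congrArg Complex.re h1
  simp only [Complex.add_re, Complex.conj_re] at h2
  linarith

theorem eLpNorm_ofReal_eq {f : Torus → ℂ} (hf : Continuous f) {p : ℝ} (hp : 0 < p) :
    eLpNorm f (ENNReal.ofReal p) torusMeasure =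
      ENNReal.ofReal ((∫ t, ‖f t‖ ^ p ∂torusMeasure) ^ p⁻¹) := by
  have hm : MemLp f (ENNReal.ofReal p) torusMeasure := ContinuousMap.memLp_torus ⟨f, hf⟩ _
  rw [hm.eLpNorm_eq_integral_rpow_norm (by simpa using hp) ENNReal.ofReal_ne_top,
    ENNReal.toReal_ofReal hp.le]

/-- The projection to nonnegative frequencies is bounded in `L ^ p`, `1 < p ≤ 2`, on positive
trigonometric polynomials. -/
theorem exists_eLpNorm_filter_nonneg_le_of_pos {p : ℝ} (hp : 1 < p) (hp2 : p ≤ 2) :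
    ∃ C : ℝ≥0∞, C ≠ ∞ ∧ ∀ a : ℤ →₀ ℂ,
      (∀ t, (trigPoly a t).im = 0 ∧ 0 < (trigPoly a t).re) →
      eLpNorm (trigPoly (a.filter (0 ≤ ·))) (ENNReal.ofReal p) torusMeasure ≤
        C * eLpNorm (trigPoly a) (ENNReal.ofReal p) torusMeasure := by
  obtain ⟨A, B, hA, hB, hAB⟩ := exists_norm_rpow_le_of_re_pos hp hp2
  have hp0 : 0 < p := by linarith
  -- The projection is `(F + a 0) / 2`: `A^{1/p}` bounds `F`, 1 bounds the mean `a 0`, and the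
  -- factor 1/2 is given away.
  refine ⟨ENNReal.ofReal (A ^ p⁻¹) + 1, by finiteness, fun a ha => ?_⟩
  have him : ∀ t, (trigPoly a t).im = 0 := fun t => (ha t).1
  have ha0 : (a 0).im = 0 := by
    have := coeff_neg_of_im_eq_zero him 0
    rw [neg_zero] at this
    exact Complex.conj_eq_iff_im.1 this.symm
  set F : ℂ → ℂ := fun z => 2 * analyticPart a z - a 0 with hF
  have hFd : Differentiable ℂ F :=
    ((differentiable_analyticPart a).const_mul 2).sub_const _
  have hre : ∀ t : Torus, (F (fourier 1 t)).re = (trigPoly a t).re := fun t => by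
    have := two_mul_re_trigPoly_filter him t
    simp only [hF, analyticPart_fourier]
    simp
    linarith
  have hpos : ∀ z ∈ Metric.sphere (0 : ℂ) 1, 0 < (F z).re := by
    intro z hz
    obtain ⟨t, ht⟩ : ∃ t : Torus, fourier 1 t = z := by
      refine ⟨(z.arg : ℝ), ?_⟩
      rw [fourier_coe_apply]
      have hz1 : ‖z‖ = 1 := by simpa using hz
      have h := Complex.norm_mul_exp_arg_mul_I z
      rw [hz1, Complex.ofReal_one, one_mul] at h
      conv_rhs => rw [← h]
      congr 1
      have : (Real.pi : ℂ) ≠ 0 := by exact_mod_cast Real.pi_ne_zero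
      push_cast
      field_simp
    rw [← ht, hre]
    exact (ha t).2
  have hF0 : (F 0).im = 0 := by simp [hF, analyticPart_zero, ha0]
  have key := integral_norm_rpow_le_of_re_pos hp hB hAB hFd hpos hF0
  have hnorm : ∀ t : Torus, (F (fourier 1 t)).re = ‖trigPoly a t‖ := fun t => by
    rw [hre, ← Complex.abs_re_eq_norm.2 (ha t).1, abs_of_pos (ha t).2]
  simp only [hnorm] at key
  have hcF : Continuous fun t : Torus => F (fourier 1 t) :=
    hFd.continuous.comp (map_continuous _)
  have hI : 0 ≤ ∫ t, ‖trigPoly a t‖ ^ p ∂torusMeasure :=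
    integral_nonneg fun t => by positivity
  have hFle : eLpNorm (fun t : Torus => F (fourier 1 t)) (ENNReal.ofReal p) torusMeasure ≤
      ENNReal.ofReal (A ^ p⁻¹) * eLpNorm (trigPoly a) (ENNReal.ofReal p) torusMeasure := by
    rw [eLpNorm_ofReal_eq hcF hp0, eLpNorm_ofReal_eq (trigPoly a).continuous hp0,
      ← ENNReal.ofReal_mul (by positivity), ← Real.mul_rpow hA hI]
    apply ENNReal.ofReal_le_ofReal
    exact Real.rpow_le_rpow (integral_nonneg fun t => by positivity) key (by positivity)
  have hp1 : (1 : ℝ≥0∞) ≤ ENNReal.ofReal p := by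
    rw [← ENNReal.ofReal_one]; exact ENNReal.ofReal_le_ofReal hp.le
  have hconst : eLpNorm (fun _ : Torus => a 0) (ENNReal.ofReal p) torusMeasure ≤
      eLpNorm (trigPoly a) (ENNReal.ofReal p) torusMeasure := by
    rw [eLpNorm_const' _ (by simpa using hp0) ENNReal.ofReal_ne_top, measure_univ,
      ENNReal.one_rpow, mul_one, ← fourierCoeff_trigPoly a]
    exact enorm_fourierCoeff_le hp1 (trigPoly a).continuous.aestronglyMeasurable 0
  have heq : (trigPoly (a.filter (0 ≤ ·)) : Torus → ℂ) =
      (2⁻¹ : ℂ) • ((fun t : Torus => F (fourier 1 t)) + fun _ => a 0) := by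
    ext t
    simp only [hF, Pi.smul_apply, Pi.add_apply, analyticPart_fourier, smul_eq_mul]
    ring
  rw [heq, eLpNorm_const_smul]
  calc _ ≤ 1 * (eLpNorm (fun t : Torus => F (fourier 1 t)) (ENNReal.ofReal p) torusMeasure
          + eLpNorm (fun _ : Torus => a 0) (ENNReal.ofReal p) torusMeasure) := by
        gcongr
        · rw [← ofReal_norm, ← ENNReal.ofReal_one]
          apply ENNReal.ofReal_le_ofReal
          norm_num
        · exact eLpNorm_add_le hcF.aestronglyMeasurable aestronglyMeasurable_const hp1
    _ ≤ _ := by rw [one_mul, add_mul, one_mul]; gcongr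

theorem exists_trigPoly_norm_sub_lt (f : C(Torus, ℂ)) {ε : ℝ} (hε : 0 < ε) :
    ∃ a : ℤ →₀ ℂ, ‖f - trigPoly a‖ < ε := by
  have hf : f ∈ (Submodule.span ℂ
      (Set.range (@fourier (2 * Real.pi)))).topologicalClosure := by
    rw [span_fourier_closure_eq_top]; trivial
  obtain ⟨g, hg, hfg⟩ := Metric.mem_closure_iff.1 hf ε hε
  obtain ⟨a, rfl⟩ := Finsupp.mem_span_range_iff_exists_finsupp.1 hg
  exact ⟨a, by rwa [dist_eq_norm] at hfg⟩

theorem exists_trigPoly_eq_re (b : ℤ →₀ ℂ) :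
    ∃ a : ℤ →₀ ℂ, ∀ t, trigPoly a t = ((trigPoly b t).re : ℂ) := by
  refine ⟨(2⁻¹ : ℂ) • (b + (b.mapRange (starRingEnd ℂ) (map_zero _)).equivMapDomain (Equiv.neg ℤ)),
    fun t => ?_⟩
  rw [map_smul, map_add, ContinuousMap.smul_apply, ContinuousMap.add_apply, ← conj_trigPoly,
    Complex.add_conj, smul_eq_mul]
  push_cast
  ring

/-- Uniform approximation of nonnegative functions by positive trigonometric polynomials. -/
theorem exists_pos_trigPoly_norm_sub_le {g : Torus → ℝ} (hg : Continuous g) (hg0 : ∀ t, 0 ≤ g t)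
    {δ : ℝ} (hδ : 0 < δ) :
    ∃ a : ℤ →₀ ℂ, (∀ t, (trigPoly a t).im = 0 ∧ 0 < (trigPoly a t).re) ∧
      ∀ t, ‖(g t : ℂ) - trigPoly a t‖ ≤ δ := by
  -- Raising `g` by `δ / 2` and approximating within `δ / 2` keeps the polynomial positive, with
  -- total error at most `δ`.
  obtain ⟨b, hb⟩ := exists_trigPoly_norm_sub_lt
    ⟨fun t => ((g t + δ / 2 : ℝ) : ℂ), by fun_prop⟩ (half_pos hδ)
  obtain ⟨a, ha⟩ := exists_trigPoly_eq_re b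
  have hb' : ∀ t, |g t + δ / 2 - (trigPoly b t).re| < δ / 2 := fun t => by
    have h1 := (ContinuousMap.norm_coe_le_norm _ t).trans_lt hb
    have h2 := (Complex.abs_re_le_norm _).trans_lt h1
    simpa using h2
  refine ⟨a, fun t => ?_, fun t => ?_⟩
  · have := (abs_lt.1 (hb' t)).2
    have := hg0 t
    rw [ha, Complex.ofReal_im, Complex.ofReal_re]
    exact ⟨rfl, by linarith⟩
  · have := abs_lt.1 (hb' t)
    rw [ha, ← Complex.ofReal_sub, Complex.norm_real, Real.norm_eq_abs, abs_le]
    constructor <;> linarith [this.1, this.2]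

theorem eLpNorm_torus_le_of_bound {f : Torus → ℂ} {c : ℝ} (p : ℝ≥0∞) (h : ∀ t, ‖f t‖ ≤ c) :
    eLpNorm f p torusMeasure ≤ ENNReal.ofReal c := by
  simpa using eLpNorm_le_of_ae_bound (p := p) (μ := torusMeasure) (Eventually.of_forall h)

/-- The projection to nonnegative frequencies is bounded in `L ^ p`, `1 < p ≤ 2`, on
trigonometric polynomials. -/
theorem exists_eLpNorm_filter_nonneg_le {p : ℝ} (hp : 1 < p) (hp2 : p ≤ 2) :
    ∃ C : ℝ≥0∞, C ≠ ∞ ∧ ∀ a : ℤ →₀ ℂ,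
      eLpNorm (trigPoly (a.filter (0 ≤ ·))) (ENNReal.ofReal p) torusMeasure ≤
        C * eLpNorm (trigPoly a) (ENNReal.ofReal p) torusMeasure := by
  obtain ⟨C, hC, h⟩ := exists_eLpNorm_filter_nonneg_le_of_pos hp hp2
  have hp1 : (1 : ℝ≥0∞) ≤ ENNReal.ofReal p := by
    rw [← ENNReal.ofReal_one]; exact ENNReal.ofReal_le_ofReal hp.le
  have hp2' : ENNReal.ofReal p ≤ 2 := by
    rw [← ENNReal.ofReal_ofNat]; exact ENNReal.ofReal_le_ofReal hp2
  refine ⟨4 * C, by finiteness, fun a => ?_⟩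
  set N : C(Torus, ℂ) → ℝ≥0∞ := fun f => eLpNorm f (ENNReal.ofReal p) torusMeasure with hN
  have hadd : ∀ f g, N (f + g) ≤ N f + N g := fun f g =>
    eLpNorm_add_le f.continuous.aestronglyMeasurable g.continuous.aestronglyMeasurable hp1
  have hsub : ∀ f g, N (f - g) ≤ N f + N g := fun f g =>
    eLpNorm_sub_le f.continuous.aestronglyMeasurable g.continuous.aestronglyMeasurable hp1
  have hI : ∀ f, N (Complex.I • f) = N f := fun f => by
    have := eLpNorm_const_smul Complex.I f (ENNReal.ofReal p) torusMeasure
    rw [← ofReal_norm, Complex.norm_I, ENNReal.ofReal_one, one_mul] at this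
    exact this
  change N _ ≤ 4 * C * N _
  -- No `L^p` bound for the projection is needed on a uniformly small remainder: the measure has
  -- mass one, so the `L^p` norm is at most the `L²` norm, which the projection does not increase.
  have hsmall : ∀ (d : ℤ →₀ ℂ) (c : ℝ), (∀ t, ‖trigPoly d t‖ ≤ c) →
      N (trigPoly (d.filter (0 ≤ ·))) ≤ ENNReal.ofReal c := fun d c hd =>
    (eLpNorm_le_eLpNorm_of_exponent_le hp2'
      (trigPoly _).continuous.aestronglyMeasurable).trans
      ((eLpNorm_two_trigPoly_filter_le d _).trans (eLpNorm_torus_le_of_bound 2 hd))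
  have step : ∀ δ : ℝ, 0 < δ → N (trigPoly (a.filter (0 ≤ ·))) ≤
      4 * C * (N (trigPoly a) + ENNReal.ofReal δ) + ENNReal.ofReal (4 * δ) := by
    intro δ hδ
    have approx : ∀ g : Torus → ℝ, Continuous g → (∀ t, |g t| ≤ ‖trigPoly a t‖) →
        ∃ b : ℤ →₀ ℂ, N (trigPoly (b.filter (0 ≤ ·))) ≤ C * (N (trigPoly a) + ENNReal.ofReal δ) ∧
          ∀ t, ‖((max (g t) 0 : ℝ) : ℂ) - trigPoly b t‖ ≤ δ := by
      intro g hg hga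
      obtain ⟨b, hb, hgb⟩ := exists_pos_trigPoly_norm_sub_le (hg.max continuous_const)
        (fun t => le_max_right (g t) 0) hδ
      refine ⟨b, (h b hb).trans ?_, hgb⟩
      gcongr
      have h1 : N (trigPoly b) ≤ eLpNorm ((fun t : Torus => (‖trigPoly a t‖ : ℂ)) + fun _ => (δ : ℂ))
          (ENNReal.ofReal p) torusMeasure := by
        refine eLpNorm_mono fun t => ?_
        rw [Pi.add_apply, ← Complex.ofReal_add, Complex.norm_real,
          Real.norm_of_nonneg (by positivity)]
        have h2 := norm_sub_norm_le (trigPoly b t) ((max (g t) 0 : ℝ) : ℂ)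
        rw [norm_sub_rev, Complex.norm_real, Real.norm_of_nonneg (le_max_right _ _)] at h2
        have h3 : max (g t) 0 ≤ ‖trigPoly a t‖ :=
          max_le ((le_abs_self _).trans (hga t)) (norm_nonneg _)
        linarith [hgb t]
      refine h1.trans ((eLpNorm_add_le ?_ aestronglyMeasurable_const hp1).trans ?_)
      · exact Continuous.aestronglyMeasurable (by fun_prop)
      · gcongr
        · refine eLpNorm_mono fun t => by simp
        · exact eLpNorm_torus_le_of_bound _ fun t => by simp [abs_of_pos hδ]
    have cre : Continuous fun t => (trigPoly a t).re :=
      Complex.continuous_re.comp (trigPoly a).continuous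
    have cim : Continuous fun t => (trigPoly a t).im :=
      Complex.continuous_im.comp (trigPoly a).continuous
    obtain ⟨b₁, hb₁, hd₁⟩ := approx _ cre fun t => Complex.abs_re_le_norm _
    obtain ⟨b₂, hb₂, hd₂⟩ := approx (fun t => -(trigPoly a t).re) cre.neg fun t => by
      rw [abs_neg]; exact Complex.abs_re_le_norm _
    obtain ⟨b₃, hb₃, hd₃⟩ := approx _ cim fun t => Complex.abs_im_le_norm _
    obtain ⟨b₄, hb₄, hd₄⟩ := approx (fun t => -(trigPoly a t).im) cim.neg fun t => by
      rw [abs_neg]; exact Complex.abs_im_le_norm _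
    -- The remainder after replacing the positive and negative parts of `re` and `im` by their
    -- approximants; each contributes at most `δ`.
    set d := a - ((b₁ - b₂) + Complex.I • (b₃ - b₄)) with hd
    have hdb : ∀ t, ‖trigPoly d t‖ ≤ 4 * δ := by
      intro t
      have e : trigPoly d t =
          (((max (trigPoly a t).re 0 : ℝ) : ℂ) - trigPoly b₁ t) -
          (((max (-(trigPoly a t).re) 0 : ℝ) : ℂ) - trigPoly b₂ t) +
          Complex.I * ((((max (trigPoly a t).im 0 : ℝ) : ℂ) - trigPoly b₃ t) -
          (((max (-(trigPoly a t).im) 0 : ℝ) : ℂ) - trigPoly b₄ t)) := by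
        have hmax : ∀ x : ℝ, ((max x 0 : ℝ) : ℂ) - ((max (-x) 0 : ℝ) : ℂ) = x := fun x => by
          rw [← Complex.ofReal_sub]
          congr 1
          rcases le_total x 0 with hx | hx
          · rw [max_eq_right hx, max_eq_left (by linarith)]; ring
          · rw [max_eq_left hx, max_eq_right (by linarith)]; ring
        have h1 := hmax (trigPoly a t).re
        have h2 := hmax (trigPoly a t).im
        have h3 := Complex.re_add_im (trigPoly a t)
        simp only [hd, map_sub, map_add, map_smul, ContinuousMap.sub_apply,
          ContinuousMap.add_apply, ContinuousMap.smul_apply, smul_eq_mul]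
        linear_combination -h3 - h1 - Complex.I * h2
      rw [e]
      refine (norm_add_le _ _).trans ?_
      rw [norm_mul, Complex.norm_I, one_mul]
      linarith [norm_sub_le (((max (trigPoly a t).re 0 : ℝ) : ℂ) - trigPoly b₁ t)
          (((max (-(trigPoly a t).re) 0 : ℝ) : ℂ) - trigPoly b₂ t),
        norm_sub_le (((max (trigPoly a t).im 0 : ℝ) : ℂ) - trigPoly b₃ t)
          (((max (-(trigPoly a t).im) 0 : ℝ) : ℂ) - trigPoly b₄ t), hd₁ t, hd₂ t, hd₃ t, hd₄ t]
    have hsum : trigPoly (a.filter (0 ≤ ·)) = ((trigPoly (b₁.filter (0 ≤ ·)) -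
        trigPoly (b₂.filter (0 ≤ ·))) + Complex.I • (trigPoly (b₃.filter (0 ≤ ·)) -
        trigPoly (b₄.filter (0 ≤ ·)))) + trigPoly (d.filter (0 ≤ ·)) := by
      have : a = ((b₁ - b₂) + Complex.I • (b₃ - b₄)) + d := by rw [hd]; abel
      conv_lhs => rw [this]
      simp only [← map_sub, ← map_smul, ← map_add]
      congr 1
      ext j
      by_cases hj : 0 ≤ j <;> simp [hj]
    rw [hsum]
    refine (hadd _ _).trans (add_le_add ((hadd _ _).trans ?_) (hsmall d _ hdb))
    rw [hI]
    refine (add_le_add (hsub _ _) (hsub _ _)).trans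
      ((add_le_add (add_le_add hb₁ hb₂) (add_le_add hb₃ hb₄)).trans (le_of_eq ?_))
    ring
  have lim : Tendsto (fun δ : ℝ => 4 * C * (N (trigPoly a) + ENNReal.ofReal δ)
      + ENNReal.ofReal (4 * δ)) (𝓝[>] 0) (𝓝 (4 * C * (N (trigPoly a) + ENNReal.ofReal 0)
      + ENNReal.ofReal (4 * 0))) := by
    refine Tendsto.mono_left ?_ nhdsWithin_le_nhds
    refine Tendsto.add (ENNReal.Tendsto.const_mul (tendsto_const_nhds.add
      (ENNReal.continuous_ofReal.tendsto 0)) (Or.inr (by finiteness))) ?_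
    exact (ENNReal.continuous_ofReal.comp (continuous_const.mul continuous_id)).tendsto 0
  have := ge_of_tendsto lim (by
    filter_upwards [self_mem_nhdsWithin] with δ hδ using step δ hδ)
  simpa using this

/-! ### Partial sums of trigonometric polynomials -/

theorem fourierPartialSum_trigPoly (n : ℕ) (a : ℤ →₀ ℂ) :
    fourierPartialSum n (trigPoly a) = trigPoly (a.filter (fun j => -(n : ℤ) ≤ j ∧ j ≤ n)) := by
  ext t
  rw [fourierPartialSum, trigPoly_apply,
    Finsupp.sum_of_support_subset _ (s := Finset.Icc (-(n : ℤ)) n)]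
  · refine Finset.sum_congr rfl fun j hj => ?_
    rw [fourierCoeff_trigPoly, Finsupp.filter_apply_pos (fun j => -(n : ℤ) ≤ j ∧ j ≤ n) _ (Finset.mem_Icc.1 hj)]
  · intro j hj
    rw [Finsupp.support_filter, Finset.mem_filter] at hj
    exact Finset.mem_Icc.2 hj.2
  · simp

theorem trigPoly_shift (a : ℤ →₀ ℂ) (k : ℤ) (t : Torus) :
    trigPoly (a.equivMapDomain (Equiv.addRight k)) t = fourier k t * trigPoly a t := by
  rw [trigPoly_apply, trigPoly_apply, Finsupp.sum_equivMapDomain, Finsupp.sum, Finsupp.sum,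
    Finset.mul_sum]
  refine Finset.sum_congr rfl fun j _ => ?_
  rw [Equiv.coe_addRight, fourier_add]
  ring

theorem eLpNorm_trigPoly_shift (a : ℤ →₀ ℂ) (k : ℤ) (p : ℝ≥0∞) :
    eLpNorm (trigPoly (a.equivMapDomain (Equiv.addRight k))) p torusMeasure =
      eLpNorm (trigPoly a) p torusMeasure := by
  refine eLpNorm_congr_norm_ae (Eventually.of_forall fun t => ?_)
  rw [trigPoly_shift, norm_mul, norm_fourier_apply, one_mul]

/-- Multiplication by `e^{ikt}` preserves every norm and shifts frequencies by `k`, so the cut may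
be moved from 0 to `k` at the same cost. -/
theorem eLpNorm_filter_le_le {p C : ℝ≥0∞} (hC : ∀ a : ℤ →₀ ℂ,
      eLpNorm (trigPoly (a.filter (0 ≤ ·))) p torusMeasure ≤
        C * eLpNorm (trigPoly a) p torusMeasure) (k : ℤ) (a : ℤ →₀ ℂ) :
    eLpNorm (trigPoly (a.filter (k ≤ ·))) p torusMeasure ≤
        C * eLpNorm (trigPoly a) p torusMeasure := by
  have h := hC (a.equivMapDomain (Equiv.addRight (-k)))
  rw [eLpNorm_trigPoly_shift, ← eLpNorm_trigPoly_shift _ k] at h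
  convert h using 4
  ext j
  simp [Finsupp.filter_apply, Finsupp.equivMapDomain_apply]

theorem exists_eLpNorm_fourierPartialSum_trigPoly_le {p : ℝ} (hp : 1 < p) (hp2 : p ≤ 2) :
    ∃ C : ℝ≥0∞, C ≠ ∞ ∧ ∀ (n : ℕ) (a : ℤ →₀ ℂ),
      eLpNorm (fourierPartialSum n (trigPoly a)) (ENNReal.ofReal p) torusMeasure ≤
        C * eLpNorm (trigPoly a) (ENNReal.ofReal p) torusMeasure := by
  obtain ⟨C, hC, h⟩ := exists_eLpNorm_filter_nonneg_le hp hp2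
  have hp1 : (1 : ℝ≥0∞) ≤ ENNReal.ofReal p := by
    rw [← ENNReal.ofReal_one]; exact ENNReal.ofReal_le_ofReal hp.le
  refine ⟨2 * C, by finiteness, fun n a => ?_⟩
  -- The window from `-n` to `n` is the half-line from `-n` minus the half-line from `n + 1`; hence
  -- the constant `2 * C`.
  have e : a.filter (fun j => -(n : ℤ) ≤ j ∧ j ≤ n) =
      a.filter (-(n : ℤ) ≤ ·) - a.filter ((n : ℤ) + 1 ≤ ·) := by
    ext j
    simp only [Finsupp.sub_apply, Finsupp.filter_apply]
    split_ifs <;> first | omega | simp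
  rw [fourierPartialSum_trigPoly, e, map_sub, ContinuousMap.coe_sub]
  refine (eLpNorm_sub_le (trigPoly _).continuous.aestronglyMeasurable
    (trigPoly _).continuous.aestronglyMeasurable hp1).trans ?_
  rw [two_mul C, add_mul]
  exact add_le_add (eLpNorm_filter_le_le h _ a) (eLpNorm_filter_le_le h _ a)

/-! ### Extension from trigonometric polynomials to `L^p` -/

theorem continuous_fourierPartialSum (n : ℕ) (f : Torus → ℂ) :
    Continuous (fourierPartialSum n f) := by
  unfold fourierPartialSum
  fun_prop

theorem memLp_fourierPartialSum (n : ℕ) (f : Torus → ℂ) (p : ℝ≥0∞) :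
    MemLp (fourierPartialSum n f) p torusMeasure :=
  ContinuousMap.memLp_torus ⟨_, continuous_fourierPartialSum n f⟩ p

theorem fourierPartialSum_sub {f g : Torus → ℂ} (hf : Integrable f torusMeasure)
    (hg : Integrable g torusMeasure) (n : ℕ) :
    fourierPartialSum n (f - g) = fourierPartialSum n f - fourierPartialSum n g := by
  ext t
  have hneg : fourierCoeff (-g) = -fourierCoeff g := by
    ext j
    have := fourierCoeff.const_smul g (-1) j
    simpa using this
  rw [Pi.sub_apply, fourierPartialSum, fourierPartialSum, fourierPartialSum,
    ← Finset.sum_sub_distrib, sub_eq_add_neg f, fourierCoeff.add hf hg.neg, hneg]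
  refine Finset.sum_congr rfl fun j _ => ?_
  simp only [Pi.add_apply, Pi.neg_apply]
  ring

/-- A crude bound for partial sums, depending on the order. -/
theorem eLpNorm_fourierPartialSum_le_card {f : Torus → ℂ} {p : ℝ≥0∞} (hp : 1 ≤ p)
    (hf : AEStronglyMeasurable f torusMeasure) (n : ℕ) :
    eLpNorm (fourierPartialSum n f) p torusMeasure ≤
      (Finset.Icc (-(n : ℤ)) n).card * eLpNorm f p torusMeasure := by
  have e : fourierPartialSum n f =
      ∑ j ∈ Finset.Icc (-(n : ℤ)) n, fourierCoeff f j • (fourier j : Torus → ℂ) := by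
    ext t
    simp only [fourierPartialSum, Finset.sum_apply, Pi.smul_apply, smul_eq_mul]
  rw [e]
  refine (eLpNorm_sum_le (fun j _ => ((map_continuous _).aestronglyMeasurable.const_smul _))
    hp).trans ?_
  rw [← nsmul_eq_mul]
  refine Finset.sum_le_card_nsmul _ _ _ fun j _ => ?_
  rw [eLpNorm_const_smul]
  calc _ ≤ eLpNorm f p torusMeasure * ENNReal.ofReal 1 := by
        gcongr
        · exact enorm_fourierCoeff_le hp hf j
        · exact eLpNorm_torus_le_of_bound p fun t => (norm_fourier_apply j t).le
    _ = _ := by simp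

theorem exists_trigPoly_eLpNorm_sub_le {f : Torus → ℂ} {p : ℝ≥0∞} (hp : 1 ≤ p) (hp_top : p ≠ ∞)
    (hf : MemLp f p torusMeasure) {ε : ℝ} (hε : 0 < ε) :
    ∃ a : ℤ →₀ ℂ, eLpNorm (f - ⇑(trigPoly a)) p torusMeasure ≤ ENNReal.ofReal ε := by
  obtain ⟨g, hfg, hg⟩ := hf.exists_boundedContinuous_eLpNorm_sub_le hp_top
    (ε := ENNReal.ofReal (ε / 2)) (by simpa using hε)
  obtain ⟨a, ha⟩ := exists_trigPoly_norm_sub_lt g.toContinuousMap (half_pos hε)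
  refine ⟨a, ?_⟩
  have e : f - ⇑(trigPoly a) = (f - g) + (g.toContinuousMap - trigPoly a : C(Torus, ℂ)) := by
    ext t; simp
  rw [e, ← add_halves ε, ENNReal.ofReal_add (half_pos hε).le (half_pos hε).le]
  refine (eLpNorm_add_le (hf.1.sub hg.1) (ContinuousMap.continuous _).aestronglyMeasurable
    hp).trans (add_le_add hfg (eLpNorm_torus_le_of_bound p fun t => ?_))
  exact (ContinuousMap.norm_coe_le_norm _ t).trans ha.le

/-- Density argument. The crude constant `K` depends on `n`, but it only multiplies the
approximation error `ε`, which tends to 0 with `n` fixed; the final bound retains `C` alone. -/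
theorem eLpNorm_fourierPartialSum_le_of_trigPoly {p C : ℝ≥0∞} (hp : 1 ≤ p) (hp_top : p ≠ ∞)
    (hC : C ≠ ∞) (n : ℕ) (h : ∀ a : ℤ →₀ ℂ,
      eLpNorm (fourierPartialSum n (trigPoly a)) p torusMeasure ≤
        C * eLpNorm (trigPoly a) p torusMeasure)
    {f : Torus → ℂ} (hf : MemLp f p torusMeasure) :
    eLpNorm (fourierPartialSum n f) p torusMeasure ≤ C * eLpNorm f p torusMeasure := by
  set K : ℝ≥0∞ := ((Finset.Icc (-(n : ℤ)) (n : ℤ)).card : ℝ≥0∞) with hK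
  have hKtop : K ≠ ∞ := ENNReal.natCast_ne_top _
  have step : ∀ ε : ℝ, 0 < ε → eLpNorm (fourierPartialSum n f) p torusMeasure ≤
      K * ENNReal.ofReal ε + C * (eLpNorm f p torusMeasure + ENNReal.ofReal ε) := by
    intro ε hε
    obtain ⟨a, ha⟩ := exists_trigPoly_eLpNorm_sub_le hp hp_top hf hε
    have hta := ContinuousMap.memLp_torus (trigPoly a) p
    have e : fourierPartialSum n f =
        fourierPartialSum n (f - ⇑(trigPoly a)) + fourierPartialSum n (trigPoly a) := by
      rw [fourierPartialSum_sub (hf.integrable hp) (hta.integrable hp), sub_add_cancel]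
    rw [e]
    refine (eLpNorm_add_le (memLp_fourierPartialSum _ _ p).1 (memLp_fourierPartialSum _ _ p).1
      hp).trans (add_le_add ?_ ((h a).trans ?_))
    · refine (eLpNorm_fourierPartialSum_le_card hp (hf.1.sub hta.1) n).trans ?_
      gcongr
    · gcongr
      have e' : (trigPoly a : Torus → ℂ) = f - (f - ⇑(trigPoly a)) := by simp
      rw [e']
      exact (eLpNorm_sub_le hf.1 (hf.1.sub hta.1) hp).trans (by gcongr)
  have lim : Tendsto (fun ε : ℝ => K * ENNReal.ofReal ε +
      C * (eLpNorm f p torusMeasure + ENNReal.ofReal ε)) (𝓝[>] 0)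
      (𝓝 (K * ENNReal.ofReal 0 + C * (eLpNorm f p torusMeasure + ENNReal.ofReal 0))) := by
    refine Tendsto.mono_left ?_ nhdsWithin_le_nhds
    have h0 := ENNReal.continuous_ofReal.tendsto 0
    exact (ENNReal.Tendsto.const_mul h0 (Or.inr hKtop)).add
      (ENNReal.Tendsto.const_mul (tendsto_const_nhds.add h0) (Or.inr hC))
  have := ge_of_tendsto lim (by
    filter_upwards [self_mem_nhdsWithin] with ε hε using step ε hε)
  simpa using this

/-! ### Duality and uniform boundedness for all exponents -/

/-- Partial sum operators are symmetric for the bilinear pairing `∫ f g`. -/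
theorem integral_fourierPartialSum_mul {f h : Torus → ℂ} (hf : Integrable f torusMeasure)
    (hh : Integrable h torusMeasure) (n : ℕ) :
    ∫ t, fourierPartialSum n f t * h t ∂torusMeasure =
      ∫ t, f t * fourierPartialSum n h t ∂torusMeasure := by
  have h1 : ∫ t, fourierPartialSum n f t * h t ∂torusMeasure =
      ∑ j ∈ Finset.Icc (-(n : ℤ)) n, fourierCoeff f j * fourierCoeff h (-j) := by
    simp only [fourierPartialSum, Finset.sum_mul]
    rw [integral_finsetSum _ fun j _ => ?_]
    · refine Finset.sum_congr rfl fun j _ => ?_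
      rw [fourierCoeff.eq_1 h, ← integral_const_mul]
      simp only [neg_neg, smul_eq_mul, mul_assoc]
    · simpa only [mul_assoc, smul_eq_mul] using (hh.fourier_smul j).const_mul (fourierCoeff f j)
  have h2 : ∫ t, f t * fourierPartialSum n h t ∂torusMeasure =
      ∑ j ∈ Finset.Icc (-(n : ℤ)) n, fourierCoeff h j * fourierCoeff f (-j) := by
    simp only [fourierPartialSum, Finset.mul_sum]
    rw [integral_finsetSum _ fun j _ => ?_]
    · refine Finset.sum_congr rfl fun j _ => ?_
      rw [fourierCoeff.eq_1 f, ← integral_const_mul]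
      congr 1; ext t
      simp only [neg_neg, smul_eq_mul]
      ring
    · have := (hf.fourier_smul j).const_mul (fourierCoeff h j)
      refine this.congr (Eventually.of_forall fun t => ?_)
      simp only [smul_eq_mul]
      ring
  rw [h1, h2]
  refine Finset.sum_nbij' (fun j => -j) (fun j => -j) ?_ ?_ ?_ ?_ ?_
  · intro j hj; simp only [Finset.mem_Icc] at hj ⊢; omega
  · intro j hj; simp only [Finset.mem_Icc] at hj ⊢; omega
  · simp
  · simp
  · intro j _; simp only [neg_neg]; ring

/-- Boundedness of a partial sum operator passes to the conjugate exponent. -/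
theorem eLpNorm_fourierPartialSum_le_of_conj {p q : ℝ} (hpq : p.HolderConjugate q) (n : ℕ)
    {C : ℝ≥0∞} (h : ∀ g : Torus → ℂ, MemLp g (ENNReal.ofReal q) torusMeasure →
      eLpNorm (fourierPartialSum n g) (ENNReal.ofReal q) torusMeasure ≤
        C * eLpNorm g (ENNReal.ofReal q) torusMeasure)
    {f : Torus → ℂ} (hf : MemLp f (ENNReal.ofReal p) torusMeasure) :
    eLpNorm (fourierPartialSum n f) (ENNReal.ofReal p) torusMeasure ≤
      C * eLpNorm f (ENNReal.ofReal p) torusMeasure := by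
  have hp1 : 1 < p := hpq.lt
  have hp0 : 0 < p := hpq.pos
  have hq0 : 0 < q := hpq.symm.pos
  have hp1' : (1 : ℝ≥0∞) ≤ ENNReal.ofReal p := by
    rw [← ENNReal.ofReal_one]; exact ENNReal.ofReal_le_ofReal hp1.le
  set g := fourierPartialSum n f with hg
  have hgc : Continuous g := continuous_fourierPartialSum n f
  -- The extremal function of Hölder's inequality: `g k = |g| ^ p` and, as `(p - 1) q = p`, also
  -- `|k| ^ q = |g| ^ p`.
  set k : Torus → ℂ := fun t => conj (g t) * ((‖g t‖ ^ (p - 2) : ℝ) : ℂ) with hk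
  have hknorm : ∀ t, ‖k t‖ = ‖g t‖ ^ (p - 1) := fun t => by
    rw [hk]
    simp only [norm_mul, RCLike.norm_conj, Complex.norm_real]
    rw [Real.norm_of_nonneg (by positivity)]
    rcases (norm_nonneg (g t)).eq_or_lt with h0 | h0
    · rw [← h0, zero_mul, Real.zero_rpow (by linarith)]
    · rw [mul_comm, ← Real.rpow_add_one h0.ne']
      congr 1; ring
  have hkm : AEStronglyMeasurable k torusMeasure := by
    apply Measurable.aestronglyMeasurable
    have := hgc.measurable
    fun_prop
  have hkLp (r : ℝ≥0∞) : MemLp k r torusMeasure := by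
    have hm : MemLp (fun t => ((‖g t‖ ^ (p - 1) : ℝ) : ℂ)) r torusMeasure :=
      ContinuousMap.memLp_torus ⟨_, Complex.continuous_ofReal.comp
        (hgc.norm.rpow_const fun _ => Or.inr (by linarith))⟩ r
    refine hm.of_le hkm (Eventually.of_forall fun t => ?_)
    rw [hknorm, Complex.norm_real, Real.norm_of_nonneg (by positivity)]
  set I := ∫ t, ‖g t‖ ^ p ∂torusMeasure with hI
  have hI0 : 0 ≤ I := integral_nonneg fun t => by positivity
  have hgk : ∫ t, g t * k t ∂torusMeasure = (I : ℂ) := by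
    rw [hI, ← integral_complex_ofReal]
    congr 1; ext t
    rw [hk]
    simp only
    rw [← mul_assoc, Complex.mul_conj, ← Complex.ofReal_mul, Complex.normSq_eq_norm_sq]
    congr 1
    rcases (norm_nonneg (g t)).eq_or_lt with h0 | h0
    · rw [← h0, Real.zero_rpow hp0.ne']; simp
    · rw [← Real.rpow_natCast, ← Real.rpow_add h0]
      congr 1; push_cast; ring
  have hkq : eLpNorm k (ENNReal.ofReal q) torusMeasure = ENNReal.ofReal (I ^ q⁻¹) := by
    rw [(hkLp _).eLpNorm_eq_integral_rpow_norm (by simpa using hq0) ENNReal.ofReal_ne_top,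
      ENNReal.toReal_ofReal hq0.le, hI]
    congr 3; ext t
    rw [hknorm, ← Real.rpow_mul (norm_nonneg _), hpq.sub_one_mul_conj]
  have hgp : eLpNorm g (ENNReal.ofReal p) torusMeasure = ENNReal.ofReal (I ^ p⁻¹) :=
    eLpNorm_ofReal_eq hgc hp0
  -- Symmetry moves `S_n` from `f` onto `k`, where the bound for `q` applies. Cancelling `I^{1/q}`
  -- afterwards leaves `I^{1/p}`, the norm of `g`.
  have main : ENNReal.ofReal I ≤
      C * eLpNorm f (ENNReal.ofReal p) torusMeasure * ENNReal.ofReal (I ^ q⁻¹) := by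
    have hfi := hf.integrable hp1'
    have hki := (hkLp 1).integrable le_rfl
    have := hpq.ennrealOfReal
    calc ENNReal.ofReal I = ‖∫ t, f t * fourierPartialSum n k t ∂torusMeasure‖ₑ := by
          rw [← integral_fourierPartialSum_mul hfi hki, hgk, ← ofReal_norm, Complex.norm_real,
            Real.norm_of_nonneg hI0]
      _ ≤ eLpNorm (f • fourierPartialSum n k) 1 torusMeasure := by
          rw [eLpNorm_one_eq_lintegral_enorm]
          exact enorm_integral_le_lintegral_enorm _
      _ ≤ eLpNorm f (ENNReal.ofReal p) torusMeasure *
            eLpNorm (fourierPartialSum n k) (ENNReal.ofReal q) torusMeasure :=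
          eLpNorm_smul_le_mul_eLpNorm (memLp_fourierPartialSum n k 1).1 hf.1
      _ ≤ eLpNorm f (ENNReal.ofReal p) torusMeasure *
            (C * eLpNorm k (ENNReal.ofReal q) torusMeasure) := by
          gcongr
          exact h k (hkLp _)
      _ = _ := by rw [hkq]; ring
  rw [hgp]
  rcases hI0.eq_or_lt with h0 | h0
  · rw [← h0, Real.zero_rpow (inv_ne_zero hp0.ne')]; simp
  · have hsplit : ENNReal.ofReal I = ENNReal.ofReal (I ^ p⁻¹) * ENNReal.ofReal (I ^ q⁻¹) := by
      rw [← ENNReal.ofReal_mul (by positivity), ← Real.rpow_add h0, hpq.inv_add_inv_eq_one,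
        Real.rpow_one]
    rw [hsplit] at main
    refine (ENNReal.mul_le_mul_iff_left ?_ ENNReal.ofReal_ne_top).1 main
    simpa using Real.rpow_pos_of_pos h0 _

/-- M. Riesz: the partial sum operators are uniformly bounded on `L ^ p` for `1 < p < ∞`. -/
theorem exists_eLpNorm_fourierPartialSum_le {p : ℝ} (hp : 1 < p) :
    ∃ C : ℝ≥0∞, C ≠ ∞ ∧ ∀ (n : ℕ) (f : Torus → ℂ), MemLp f (ENNReal.ofReal p) torusMeasure →
      eLpNorm (fourierPartialSum n f) (ENNReal.ofReal p) torusMeasure ≤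
        C * eLpNorm f (ENNReal.ofReal p) torusMeasure := by
  have small : ∀ {r : ℝ}, 1 < r → r ≤ 2 → ∃ C : ℝ≥0∞, C ≠ ∞ ∧ ∀ (n : ℕ) (f : Torus → ℂ),
      MemLp f (ENNReal.ofReal r) torusMeasure →
      eLpNorm (fourierPartialSum n f) (ENNReal.ofReal r) torusMeasure ≤
        C * eLpNorm f (ENNReal.ofReal r) torusMeasure := by
    intro r hr hr2
    obtain ⟨C, hC, h⟩ := exists_eLpNorm_fourierPartialSum_trigPoly_le hr hr2
    refine ⟨C, hC, fun n f hf => eLpNorm_fourierPartialSum_le_of_trigPoly ?_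
      ENNReal.ofReal_ne_top hC n (h n) hf⟩
    rw [← ENNReal.ofReal_one]; exact ENNReal.ofReal_le_ofReal hr.le
  rcases le_total p 2 with h2 | h2
  · exact small hp h2
  · have hpq := Real.HolderConjugate.conjExponent hp
    have hq2 : p.conjExponent ≤ 2 := by
      rw [Real.conjExponent, div_le_iff₀ (by linarith)]
      linarith
    obtain ⟨C, hC, h⟩ := small hpq.symm.lt hq2
    exact ⟨C, hC, fun n f hf => eLpNorm_fourierPartialSum_le_of_conj hpq n (h n) hf⟩

/-! ### Convergence in `L^p` -/

theorem fourierPartialSum_trigPoly_eventually_eq (a : ℤ →₀ ℂ) :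
    ∀ᶠ n : ℕ in atTop, fourierPartialSum n (trigPoly a) = trigPoly a := by
  obtain ⟨N, hN⟩ : ∃ N : ℕ, ∀ j ∈ a.support, j.natAbs ≤ N :=
    ⟨a.support.sup Int.natAbs, fun j hj => Finset.le_sup (f := Int.natAbs) hj⟩
  filter_upwards [eventually_ge_atTop N] with n hn
  rw [fourierPartialSum_trigPoly, (Finsupp.filter_eq_self_iff _ _).2 fun j hj => ?_]
  have := hN j (Finsupp.mem_support_iff.2 hj)
  omega

theorem theorem9p5 (p : ℝ≥0∞) (hp_one : 1 < p) (hp_top : p < ∞)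
    (f : Torus → ℂ) (hf : MemLp f p torusMeasure) :
    (∀ n : ℕ, MemLp (fourierPartialSum n f) p torusMeasure) ∧
      Tendsto (fun n : ℕ => eLpNorm (fourierPartialSum n f - f) p torusMeasure)
        atTop (𝓝 0) := by
  refine ⟨fun n => memLp_fourierPartialSum n f p, ?_⟩
  lift p to NNReal using hp_top.ne
  obtain ⟨C, hC, hbound⟩ := exists_eLpNorm_fourierPartialSum_le (p := (p : ℝ))
    (by exact_mod_cast hp_one)
  rw [ENNReal.ofReal_coe_nnreal] at hbound
  rw [ENNReal.tendsto_nhds_zero]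
  intro ε hε
  have lim : Tendsto (fun δ : ℝ => (C + 1) * ENNReal.ofReal δ) (𝓝[>] 0)
      (𝓝 ((C + 1) * ENNReal.ofReal 0)) :=
    (ENNReal.Tendsto.const_mul (ENNReal.continuous_ofReal.tendsto 0)
      (Or.inr (by finiteness))).mono_left nhdsWithin_le_nhds
  rw [ENNReal.ofReal_zero, mul_zero] at lim
  obtain ⟨δ, hδε, hδ⟩ := ((lim.eventually_le_const hε).and self_mem_nhdsWithin).exists
  obtain ⟨a, ha⟩ := exists_trigPoly_eLpNorm_sub_le hp_one.le hp_top.ne hf hδ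
  have hta := ContinuousMap.memLp_torus (trigPoly a) p
  filter_upwards [fourierPartialSum_trigPoly_eventually_eq a] with n hn
  -- Since `S_n` fixes the approximant for such `n`, only `f - trigPoly a` matters: its image costs
  -- `C δ` and the function itself `δ`.
  have e : fourierPartialSum n f - f =
      fourierPartialSum n (f - ⇑(trigPoly a)) - (f - ⇑(trigPoly a)) := by
    rw [fourierPartialSum_sub (hf.integrable hp_one.le) (hta.integrable hp_one.le), hn]
    abel
  rw [e]
  refine (eLpNorm_sub_le (memLp_fourierPartialSum _ _ p).1 (hf.1.sub hta.1)
    hp_one.le).trans (le_trans ?_ hδε)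
  rw [add_mul, one_mul]
  exact add_le_add ((hbound n _ (hf.sub hta)).trans (by gcongr)) ha
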